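/- Let $\mathbb D$ be the open unit disc of $\mathbb C$ and let $H(\mathbb D)$ be the space of analytic functions on $\mathbb D$ with the compact-open topology $co$. Let $g\in H(\mathbb D)$, let $\varphi\colon\mathbb D\to\mathbb D$ be analytic, and let $$T_g^{\varphi}(f)(z)=\int_0^{\varphi(z)} f(\xi)g'(\xi)\,d\xi,\qquad f\in H(\mathbb D),\ z\in\mathbb D .$$ A weight is a continuous, strictly positive function $v\colon\mathbb D\to\mathbb R$ with $\lim_{|z|\to1}v(z)=0$. It is normal if it is radial ($v(z)=v(|z|)$), non-increasing with respect to $|z|$, and satisfies $$\inf_{k\in\mathbb N}\limsup_{n\to\infty}\frac{v(1-2^{-n-k})}{v(1-2^{-n})}<1\quad\text{and}\quad \sup_{n\in\mathbb N}\frac{v(1-2^{-n})}{v(1-2^{-n-1})}<\infty .$$ For a weight $v$ let $$H_v^\infty=\{f\in H(\mathbb D):\|f\|_{H_v^\infty}=\sup_{z}v(z)|f(z)|<\infty\},\qquad H_v^0=\{f\in H_v^\infty:\lim_{|z|\to1^-}v(z)|f(z)|=0\},$$ $$\mathcal B_v^\infty=\{f\in H(\mathbb D):\|f\|_{\mathcal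 B_v^\infty}=|f(0)|+\sup_{z}v(z)|f'(z)|<\infty\},\qquad \mathcal B_v^0=\{f\in \mathcal B_v^\infty:\lim_{|z|\to1^-}v(z)|f'(z)|=0\},$$ where $H_v^0$ and $\mathcal B_v^0$ carry the norms of $H_v^\infty$ and $\mathcal B_v^\infty$. Let $\mathcal X\subset H(\mathbb D)$ be a Banach space (with its own norm) that contains the constant functions. Let $\delta_z(f)=f(z)$ and $f_r(z)=f(rz)$, and consider the following conditions: (I) the closed unit ball of $\mathcal X$ is compact with respect to $co$; (II) $\lim_{|z|\to1}\|\delta_z\|_{\mathcal X\to\mathbb C}=\infty$; (III) for every $0<r<1$, $T_r\colon f\mapsto f_r$ is a compact operator $\mathcal X\to\mathcal X$; (IV) the operators $T_r\colon\mathcal X\to\mathcal X$, $f\mapsto f_r$, are well defined and bounded for $0<r<1$, and $\sup_{0<r<1}\|T_r\|_{\mathcal X\to\mathcal X}<\infty$; (V) there is a constant $c>0$ such that for every bounded $u\in H(\mathbb D)$ the multiplication $M_u f=uf$ is a bounded operator $\mathcal X\to\mathcal X$ with $\|M_u\|_{\mathcal X\to\mathcal X}\le c\,\|u\|_\infty$.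 That $T_g^\varphi\colon\mathcal X\to\mathcal Y$ is compact means that $T_g^\varphi(\mathcal X)\subset\mathcal Y$ and that the resulting linear operator is compact. Then: (i) If $\mathcal X$ satisfies (I)–(V) and the weight $v$ is normal, then $T_g^\varphi\colon\mathcal X\to H_v^\infty$ is compact if and only if $T_g^\varphi\colon\mathcal X\to H_v^0$ is compact. (ii) If $\mathcal X$ satisfies (I) and (IV), then for any weight $v$, $T_g^\varphi\colon\mathcal X\to\mathcal B_v^0$ is compact if and only if $T_g^\varphi\colon\mathcal X\to\mathcal B_v^\infty$ is compact and $g\circ\varphi\in\mathcal B_v^0$. -/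

import Mathlib

open Filter Topology

noncomputable section

namespace VolterraDisc

/-- The open unit disc of the complex plane. -/
abbrev Disc : Set ℂ := Metric.ball (0 : ℂ) 1

/-- The centre of the disc. -/
def origin : Disc := ⟨0, by simp⟩

/-- Extension by zero, so that the complex derivative `deriv` can be used for functions that are
only given on the disc. -/
def zeroExt (F : Disc → ℂ) (z : ℂ) : ℂ := by
  classical exact if h : z ∈ Disc then F ⟨z, h⟩ else 0

theorem zeroExt_of_mem (F : Disc → ℂ) {z : ℂ} (h : z ∈ Disc) : zeroExt F z = F ⟨z, h⟩ := by
  simp only [zeroExt]; exact dif_pos h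

theorem zeroExt_coe (F : Disc → ℂ) (z : Disc) : zeroExt F z = F z :=
  zeroExt_of_mem F z.2

/-- Analyticity of a function on the disc. -/
def IsHol (F : Disc → ℂ) : Prop := DifferentiableOn ℂ (zeroExt F) Disc

/-- The analytic functions on the disc, as a subspace of the continuous ones. -/
def holSubmodule : Submodule ℂ C(Disc, ℂ) where
  carrier := {f | IsHol f}
  add_mem' {f g} hf hg := (DifferentiableOn.add hf hg).congr fun z hz => by
    simp only [Pi.add_apply, zeroExt_of_mem _ hz, ContinuousMap.add_apply]
  zero_mem' := (differentiableOn_const (c := (0 : ℂ))).congr fun z hz => by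
    simp only [zeroExt_of_mem _ hz, ContinuousMap.zero_apply]
  smul_mem' c f hf := (DifferentiableOn.const_smul hf c).congr fun z hz => by
    simp only [Pi.smul_apply, zeroExt_of_mem _ hz, ContinuousMap.smul_apply]

/-- The space `H(𝔻)` of analytic functions on the disc. -/
def HolD : Type := holSubmodule

instance : AddCommGroup HolD := inferInstanceAs (AddCommGroup holSubmodule)

instance : Module ℂ HolD := inferInstanceAs (Module ℂ holSubmodule)

/-- `H(𝔻)` carries the compact-open topology, as a subspace of `C(Disc, ℂ)`. -/
instance : TopologicalSpace HolD := inferInstanceAs (TopologicalSpace holSubmodule)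

/-- The value `f z`. -/
def HolD.val (f : HolD) (z : Disc) : ℂ := f.1 z

theorem HolD.val_zero (z : Disc) : (0 : HolD).val z = 0 := rfl

/-- The value `f'(z)` of the complex derivative. -/
def HolD.der (f : HolD) (z : Disc) : ℂ := deriv (zeroExt f.val) z

theorem HolD.isHol (f : HolD) : IsHol f.val := f.2

theorem HolD.differentiableAt (f : HolD) (z : Disc) :
    DifferentiableAt ℂ (zeroExt f.val) z :=
  (f.isHol z z.2).differentiableAt (Metric.isOpen_ball.mem_nhds z.2)

theorem HolD.ext_val {f g : HolD} (h : ∀ z, f.val z = g.val z) : f = g :=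
  Subtype.ext (ContinuousMap.ext h)

theorem HolD.der_add (f g : HolD) (z : Disc) : (f + g).der z = f.der z + g.der z := by
  have h : zeroExt (f + g).val = zeroExt f.val + zeroExt g.val := by
    funext w
    by_cases hw : w ∈ Disc
    · simp only [Pi.add_apply, zeroExt_of_mem _ hw]; rfl
    · simp only [Pi.add_apply, zeroExt, hw, dite_false, add_zero]
  simp only [HolD.der, h]
  exact deriv_add (f.differentiableAt z) (g.differentiableAt z)

theorem HolD.der_smul (c : ℂ) (f : HolD) (z : Disc) : (c • f).der z = c * f.der z := by
  have h : zeroExt (c • f).val = fun w => c * zeroExt f.val w := by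
    funext w
    by_cases hw : w ∈ Disc
    · simp only [zeroExt_of_mem _ hw]; rfl
    · simp only [zeroExt, hw, dite_false, mul_zero]
  simp only [HolD.der, h]
  exact deriv_const_mul c (f.differentiableAt z)

theorem HolD.eq_zero_of_der {f : HolD} (h0 : f.val origin = 0) (h : ∀ z, f.der z = 0) : f = 0 := by
  apply HolD.ext_val
  intro z
  have := Metric.isOpen_ball.is_const_of_deriv_eq_zero
    (convex_ball (0 : ℂ) 1).isPreconnected f.isHol (fun w hw => h ⟨w, hw⟩) z.2 origin.2
  rw [zeroExt_coe, zeroExt_coe, h0] at this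
  exact this

/-- The filter `|z| → 1` on the disc. -/
def toBoundary : Filter Disc := comap (fun z : Disc => ‖(z : ℂ)‖) (𝓝 1)

/-- Analytic selfmaps of the disc. -/
structure SelfMap where
  toFun : Disc → Disc
  isHol : IsHol fun z => (toFun z : ℂ)

/-- The composition `g ∘ φ`. -/
def HolD.comp (g : HolD) (φ : SelfMap) : HolD :=
  have h : IsHol fun z => g.val (φ.toFun z) :=
    (DifferentiableOn.comp g.isHol φ.isHol fun z hz => by
      rw [zeroExt_of_mem _ hz]; exact (φ.toFun ⟨z, hz⟩).2).congr fun z hz => by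
      simp only [Function.comp_apply, zeroExt_of_mem _ hz, zeroExt_coe]
  ⟨⟨fun z => g.val (φ.toFun z), by
    have hc := h.continuousOn.domRestrict
    refine hc.congr fun z => ?_
    simp only [Set.domRestrict_apply, zeroExt_coe]⟩, h⟩

/-- The generalized Volterra operator
`T_g^φ(f)(z) = ∫_0^{φ(z)} f(ξ) g'(ξ) dξ`, the integral being taken along the segment
`ξ = t φ(z)`, `0 ≤ t ≤ 1`. -/
def volterra (g : HolD) (φ : SelfMap) (f : HolD) (z : Disc) : ℂ :=
  ∫ t in (0 : ℝ)..1, zeroExt f.val ((t : ℂ) * (φ.toFun z : ℂ)) *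
    zeroExt g.der ((t : ℂ) * (φ.toFun z : ℂ)) * (φ.toFun z : ℂ)

/-- Weights: continuous strictly positive functions on the disc with `v(z) → 0` as `|z| → 1`. -/
structure Weight where
  toFun : Disc → ℝ
  continuous : Continuous toFun
  pos : ∀ z, 0 < toFun z
  tendsto_zero : Tendsto toFun toBoundary (𝓝 0)

instance : CoeFun Weight fun _ => Disc → ℝ := ⟨Weight.toFun⟩

/-- The point `1 - 2^{-n}` of the disc. -/
def dyadicPt (n : ℕ) : Disc := ⟨((1 - (2⁻¹ : ℝ) ^ n : ℝ) : ℂ), by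
  have h1 : (0 : ℝ) < 2⁻¹ ^ n := by positivity
  have h2 : (2⁻¹ : ℝ) ^ n ≤ 1 := pow_le_one₀ (by norm_num) (by norm_num)
  rw [Metric.mem_ball, dist_zero_right, Complex.norm_real, Real.norm_eq_abs, abs_lt]
  constructor <;> linarith⟩

/-- Normal weights. Since `v` is positive and non-increasing in `|z|`, all quotients in `limsup_lt`
lie in `(0, 1]`, so that the real `limsup` and `⨅` have their usual meaning. -/
structure Weight.IsNormal (v : Weight) : Prop where
  radial : ∀ z w : Disc, ‖(z : ℂ)‖ = ‖(w : ℂ)‖ → v z = v w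
  antitone : ∀ z w : Disc, ‖(z : ℂ)‖ ≤ ‖(w : ℂ)‖ → v w ≤ v z
  limsup_lt : (⨅ k : ℕ, limsup (fun n : ℕ => v (dyadicPt (n + k)) / v (dyadicPt n)) atTop) < 1
  sup_finite : BddAbove (Set.range fun n : ℕ => v (dyadicPt n) / v (dyadicPt (n + 1)))

theorem bddAbove_add (v : Weight) {a b c : Disc → ℂ} (hc : ∀ z, c z = a z + b z)
    (ha : BddAbove (Set.range fun z => v z * ‖a z‖))
    (hb : BddAbove (Set.range fun z => v z * ‖b z‖)) :
    BddAbove (Set.range fun z => v z * ‖c z‖) ∧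
      (⨆ z, v z * ‖c z‖) ≤ (⨆ z, v z * ‖a z‖) + ⨆ z, v z * ‖b z‖ := by
  have key : ∀ z, v z * ‖c z‖ ≤ (⨆ z, v z * ‖a z‖) + ⨆ z, v z * ‖b z‖ := fun z => by
    have h1 := le_ciSup ha z
    have h2 := le_ciSup hb z
    have h3 := mul_le_mul_of_nonneg_left (norm_add_le (a z) (b z)) (v.pos z).le
    rw [← hc, mul_add] at h3
    exact h3.trans (add_le_add h1 h2)
  have : Nonempty Disc := ⟨origin⟩
  exact ⟨⟨_, by rintro _ ⟨z, rfl⟩; exact key z⟩, ciSup_le key⟩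

theorem bddAbove_smul (v : Weight) {a c : Disc → ℂ} (r : ℂ) (hc : ∀ z, c z = r * a z)
    (ha : BddAbove (Set.range fun z => v z * ‖a z‖)) :
    BddAbove (Set.range fun z => v z * ‖c z‖) := by
  obtain ⟨M, hM⟩ := ha
  refine ⟨‖r‖ * M, ?_⟩
  rintro _ ⟨z, rfl⟩
  have := mul_le_mul_of_nonneg_left (hM ⟨z, rfl⟩) (norm_nonneg r)
  simp only [hc, norm_mul] at this ⊢
  linarith

theorem iSup_smul_eq (v : Weight) {a c : Disc → ℂ} (r : ℂ) (hc : ∀ z, c z = r * a z) :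
    (⨆ z, v z * ‖c z‖) = ‖r‖ * ⨆ z, v z * ‖a z‖ := by
  rw [Real.mul_iSup_of_nonneg (norm_nonneg r)]
  congr 1; funext z; rw [hc, norm_mul]; ring

theorem eq_zero_of_iSup (v : Weight) {a : Disc → ℂ}
    (ha : BddAbove (Set.range fun z => v z * ‖a z‖)) (h : (⨆ z, v z * ‖a z‖) ≤ 0) (z : Disc) :
    a z = 0 := by
  have h1 := (le_ciSup ha z).trans h
  have h2 : ‖a z‖ ≤ 0 := nonpos_of_mul_nonpos_right h1 (v.pos z)
  exact norm_le_zero_iff.1 h2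

theorem iSup_weight_nonneg (v : Weight) (a : Disc → ℂ) : 0 ≤ ⨆ z, v z * ‖a z‖ :=
  Real.iSup_nonneg fun z => mul_nonneg (v.pos z).le (norm_nonneg _)

theorem tendsto_weight_add (v : Weight) {a b c : Disc → ℂ} (hc : ∀ z, c z = a z + b z)
    (ha : Tendsto (fun z => v z * ‖a z‖) toBoundary (𝓝 0))
    (hb : Tendsto (fun z => v z * ‖b z‖) toBoundary (𝓝 0)) :
    Tendsto (fun z => v z * ‖c z‖) toBoundary (𝓝 0) := by
  refine squeeze_zero (fun z => mul_nonneg (v.pos z).le (norm_nonneg _)) (fun z => ?_)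
    (by simpa using ha.add hb)
  have h3 := mul_le_mul_of_nonneg_left (norm_add_le (a z) (b z)) (v.pos z).le
  rw [← hc, mul_add] at h3
  exact h3

theorem tendsto_weight_smul (v : Weight) {a c : Disc → ℂ} (r : ℂ) (hc : ∀ z, c z = r * a z)
    (ha : Tendsto (fun z => v z * ‖a z‖) toBoundary (𝓝 0)) :
    Tendsto (fun z => v z * ‖c z‖) toBoundary (𝓝 0) := by
  have h := ha.const_mul ‖r‖
  rw [mul_zero] at h
  refine h.congr fun z => ?_
  rw [hc, norm_mul]; ring

theorem HolD.der_zero (z : Disc) : (0 : HolD).der z = 0 := by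
  have := HolD.der_smul 0 0 z
  rwa [zero_smul, zero_mul] at this

/-! ### The weighted spaces `H_v^∞` and `H_v^0` -/

/-- The analytic functions with `sup_z v(z)|f(z)| < ∞`. -/
def hvInfSubmodule (v : Weight) : Submodule ℂ HolD where
  carrier := {f | BddAbove (Set.range fun z => v z * ‖f.val z‖)}
  add_mem' {_ _} hf hg := (bddAbove_add v (fun _ => rfl) hf hg).1
  zero_mem' := ⟨0, by rintro _ ⟨z, rfl⟩; simp [HolD.val_zero]⟩
  smul_mem' c _ hf := bddAbove_smul v c (fun _ => rfl) hf

/-- The space `H_v^∞`. It is a separate type since its topology is given by its norm, not by the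
compact-open topology. -/
def HvInf (v : Weight) : Type := hvInfSubmodule v

instance (v : Weight) : AddCommGroup (HvInf v) :=
  inferInstanceAs (AddCommGroup (hvInfSubmodule v))

instance (v : Weight) : Module ℂ (HvInf v) :=
  inferInstanceAs (Module ℂ (hvInfSubmodule v))

/-- The inclusion `H_v^∞ ⊂ H(𝔻)`. -/
def HvInf.incl (v : Weight) : HvInf v →ₗ[ℂ] HolD := (hvInfSubmodule v).subtype

/-- `‖f‖ = sup_z v(z)|f(z)|`. -/
instance (v : Weight) : Norm (HvInf v) := ⟨fun f => ⨆ z, v z * ‖(HvInf.incl v f).val z‖⟩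

theorem HvInf.core (v : Weight) : NormedSpace.Core ℂ (HvInf v) where
  norm_nonneg f := iSup_weight_nonneg v _
  norm_smul c f := iSup_smul_eq v c fun _ => rfl
  norm_triangle f g := (bddAbove_add v (fun _ => rfl) f.2 g.2).2
  norm_eq_zero_iff f := by
    constructor
    · intro h
      exact Subtype.ext (HolD.ext_val (eq_zero_of_iSup v f.2 (le_of_eq h)))
    · rintro rfl
      have := iSup_smul_eq v (a := (HvInf.incl v 0).val) (c := (HvInf.incl v 0).val) 0
        fun z => by simp [HolD.val_zero]
      rw [norm_zero, zero_mul] at this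
      exact this

instance (v : Weight) : NormedAddCommGroup (HvInf v) := NormedAddCommGroup.ofCore (HvInf.core v)

instance (v : Weight) : NormedSpace ℂ (HvInf v) := NormedSpace.ofCore (HvInf.core v)

/-- The space `H_v^0`, with the norm of `H_v^∞`. -/
def Hv0 (v : Weight) : Submodule ℂ (HvInf v) where
  carrier := {f | Tendsto (fun z => v z * ‖(HvInf.incl v f).val z‖) toBoundary (𝓝 0)}
  add_mem' {_ _} hf hg := tendsto_weight_add v (fun _ => rfl) hf hg
  zero_mem' := by simp [HolD.val_zero, tendsto_const_nhds]
  smul_mem' c _ hf := tendsto_weight_smul v c (fun _ => rfl) hf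

/-- The inclusion `H_v^0 ⊂ H(𝔻)`. -/
def Hv0.incl (v : Weight) : Hv0 v →ₗ[ℂ] HolD := HvInf.incl v ∘ₗ (Hv0 v).subtype

/-! ### The Bloch-type spaces `B_v^∞` and `B_v^0` -/

/-- The analytic functions with `sup_z v(z)|f'(z)| < ∞`. -/
def bvInfSubmodule (v : Weight) : Submodule ℂ HolD where
  carrier := {f | BddAbove (Set.range fun z => v z * ‖f.der z‖)}
  add_mem' {f g} hf hg := (bddAbove_add v (HolD.der_add f g) hf hg).1
  zero_mem' := ⟨0, by rintro _ ⟨z, rfl⟩; simp [HolD.der_zero]⟩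
  smul_mem' c f hf := bddAbove_smul v c (HolD.der_smul c f) hf

/-- The Bloch-type space `B_v^∞`, topologized by its norm. -/
def BvInf (v : Weight) : Type := bvInfSubmodule v

instance (v : Weight) : AddCommGroup (BvInf v) :=
  inferInstanceAs (AddCommGroup (bvInfSubmodule v))

instance (v : Weight) : Module ℂ (BvInf v) :=
  inferInstanceAs (Module ℂ (bvInfSubmodule v))

/-- The inclusion `B_v^∞ ⊂ H(𝔻)`. -/
def BvInf.incl (v : Weight) : BvInf v →ₗ[ℂ] HolD := (bvInfSubmodule v).subtype

/-- `‖f‖ = |f(0)| + sup_z v(z)|f'(z)|`. -/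
instance (v : Weight) : Norm (BvInf v) :=
  ⟨fun f => ‖(BvInf.incl v f).val origin‖ + ⨆ z, v z * ‖(BvInf.incl v f).der z‖⟩

theorem BvInf.core (v : Weight) : NormedSpace.Core ℂ (BvInf v) where
  norm_nonneg f := add_nonneg (norm_nonneg _) (iSup_weight_nonneg v _)
  norm_smul c f := by
    have h1 := iSup_smul_eq v c (HolD.der_smul c (BvInf.incl v f))
    have h2 : ‖(BvInf.incl v (c • f)).val origin‖ = ‖c‖ * ‖(BvInf.incl v f).val origin‖ :=
      norm_mul c _
    change _ + (⨆ z, v z * ‖(c • BvInf.incl v f).der z‖) = ‖c‖ * (_ + _)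
    rw [h1, h2, mul_add]
  norm_triangle f g := by
    have h1 := (bddAbove_add v (HolD.der_add (BvInf.incl v f) (BvInf.incl v g)) f.2 g.2).2
    have h2 : ‖(BvInf.incl v (f + g)).val origin‖ ≤
      ‖(BvInf.incl v f).val origin‖ + ‖(BvInf.incl v g).val origin‖ := norm_add_le _ _
    exact (add_le_add h2 h1).trans (le_of_eq (add_add_add_comm _ _ _ _))
  norm_eq_zero_iff f := by
    constructor
    · intro h
      change _ + _ = (0 : ℝ) at h
      have h1 := norm_nonneg ((BvInf.incl v f).val origin)
      have h2 := iSup_weight_nonneg v (BvInf.incl v f).der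
      have h3 : ‖(BvInf.incl v f).val origin‖ ≤ 0 := by linarith
      have h4 : (⨆ z, v z * ‖(BvInf.incl v f).der z‖) ≤ 0 := by linarith
      exact Subtype.ext (HolD.eq_zero_of_der (norm_le_zero_iff.1 h3) (eq_zero_of_iSup v f.2 h4))
    · rintro rfl
      change _ + _ = (0 : ℝ)
      simp [HolD.val_zero, HolD.der_zero]

instance (v : Weight) : NormedAddCommGroup (BvInf v) := NormedAddCommGroup.ofCore (BvInf.core v)

instance (v : Weight) : NormedSpace ℂ (BvInf v) := NormedSpace.ofCore (BvInf.core v)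

/-- The little Bloch-type space `B_v^0`, with the norm of `B_v^∞`. -/
def Bv0 (v : Weight) : Submodule ℂ (BvInf v) where
  carrier := {f | Tendsto (fun z => v z * ‖(BvInf.incl v f).der z‖) toBoundary (𝓝 0)}
  add_mem' {f g} hf hg :=
    tendsto_weight_add v (HolD.der_add (BvInf.incl v f) (BvInf.incl v g)) hf hg
  zero_mem' := by simp [HolD.der_zero, tendsto_const_nhds]
  smul_mem' c f hf := tendsto_weight_smul v c (HolD.der_smul c (BvInf.incl v f)) hf

/-- The inclusion `B_v^0 ⊂ H(𝔻)`. -/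
def Bv0.incl (v : Weight) : Bv0 v →ₗ[ℂ] HolD := BvInf.incl v ∘ₗ (Bv0 v).subtype

/-! ### Banach spaces of analytic functions

A Banach space `X ⊂ H(𝔻)` is a Banach space `X` with an injective linear map `ι : X → H(𝔻)`. -/

section Conditions

variable {X : Type*} [NormedAddCommGroup X] [NormedSpace ℂ X]

/-- `X` contains the constant functions. -/
def ContainsConstants (ι : X →ₗ[ℂ] HolD) : Prop := ∀ c : ℂ, ∃ f : X, ∀ z, (ι f).val z = c

/-- Condition (I): the closed unit ball is compact in the compact-open topology. -/
def CondI (ι : X →ₗ[ℂ] HolD) : Prop := IsCompact (ι '' Metric.closedBall 0 1)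

/-- The norm `‖δ_z‖` of the evaluation functional (`∞` if it is unbounded). -/
def evalNorm (ι : X →ₗ[ℂ] HolD) (z : Disc) : ENNReal :=
  ⨆ f ∈ Metric.closedBall (0 : X) 1, ‖(ι f).val z‖ₑ

/-- Condition (II): `‖δ_z‖ → ∞` as `|z| → 1`. -/
def CondII (ι : X →ₗ[ℂ] HolD) : Prop := Tendsto (evalNorm ι) toBoundary (𝓝 ⊤)

/-- `T` is the dilation `f ↦ f_r`, `f_r(z) = f(rz)`, on `X`. -/
def IsDilation (ι : X →ₗ[ℂ] HolD) (r : ℝ) (T : X → X) : Prop :=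
  ∀ f z, (ι (T f)).val z = zeroExt (ι f).val ((r : ℂ) * z)

/-- Condition (III): all dilations, `0 < r < 1`, are compact operators on `X`. -/
def CondIII (ι : X →ₗ[ℂ] HolD) : Prop :=
  ∀ r ∈ Set.Ioo (0 : ℝ) 1, ∃ T : X →ₗ[ℂ] X, IsDilation ι r T ∧ IsCompactOperator T

/-- Condition (IV): the dilations, `0 < r < 1`, are uniformly bounded operators on `X`. -/
def CondIV (ι : X →ₗ[ℂ] HolD) : Prop :=
  ∃ C : ℝ, ∀ r ∈ Set.Ioo (0 : ℝ) 1, ∃ T : X →L[ℂ] X, IsDilation ι r T ∧ ‖T‖ ≤ C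

/-- Condition (V): every `u ∈ H^∞` multiplies `X` into `X`, with `‖M_u‖ ≤ c ‖u‖_∞`. -/
def CondV (ι : X →ₗ[ℂ] HolD) : Prop :=
  ∃ c : ℝ, 0 < c ∧ ∀ u : HolD, BddAbove (Set.range fun z => ‖u.val z‖) →
    ∃ M : X →L[ℂ] X, (∀ f z, (ι (M f)).val z = u.val z * (ι f).val z) ∧
      ‖M‖ ≤ c * ⨆ z, ‖u.val z‖

/-- The map `T`, defined on `H(𝔻)`, maps the space `X` into the space `Y`, both embedded in `H(𝔻)`,
and is a compact linear operator `X → Y`. -/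
def IsCompactBetween {Y : Type*} [NormedAddCommGroup Y] [NormedSpace ℂ Y]
    (ι : X →ₗ[ℂ] HolD) (κ : Y →ₗ[ℂ] HolD) (T : HolD → Disc → ℂ) : Prop :=
  ∃ S : X →ₗ[ℂ] Y, (∀ f z, (κ (S f)).val z = T (ι f) z) ∧ IsCompactOperator S

end Conditions

end VolterraDisc

end

open VolterraDisc

namespace VolterraDisc

/-! ### Analytic functions on the disc -/

/-! Everything rests on `(T f)' = (f ∘ φ) (g ∘ φ)'`, where `T = T_g^φ` (`der_of_val_eq_volterra`).
The little spaces are closed, so compactness into the big space passes to the little one as soon as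
every single `T f` lies in it. To see this, compactness is tested on a bounded sequence in `X` built
from `f`.

Bloch case: `(T 1)' = (g ∘ φ)'` gives the condition on `g ∘ φ`. Conversely, let `r → 1`. The
dilations `f_r` are bounded on the disc, so `T f_r ∈ B_v^0`, and (IV) bounds them in `X`. A
subsequence of `T f_r` converges in norm; its limit lies in `B_v^0` and has derivative `(T f)'`
(`mem_Bv0_of_isCompactOperator`).

Growth case: (V) bounds `z^n f` in `X`, and `(T(z^n f))' = φ^n (T f)'` tends to `0` pointwise. For
normal `v`, differentiation is bounded from `H_v^∞` to the weight `(1 - |z|) v`, so compactness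
makes `|φ|^n (1 - |z|) v |(T f)'|` uniformly small for some `n`. This controls the points where
`|φ|` is near `1`; elsewhere `f ∘ φ` and `g' ∘ φ` are bounded, `(1 - |z|)|φ'| ≤ 2` and `v → 0`.
Hence `(1 - |z|) v |(T f)'| → 0`, and integrating over dyadic shells yields `v |T f| → 0`
(`tendsto_val_of_tendsto_der`). -/

theorem eventually_toBoundary {p : Disc → Prop} :
    (∀ᶠ z in toBoundary, p z) ↔ ∃ r < (1 : ℝ), ∀ z : Disc, r < ‖(z : ℂ)‖ → p z := by
  rw [toBoundary, eventually_comap]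
  constructor
  · intro h
    obtain ⟨l, hl, h⟩ := mem_nhdsLE_iff_exists_Ioc_subset.1 (mem_nhdsWithin_of_mem_nhds h)
    exact ⟨l, hl, fun z hz => h ⟨hz, (mem_ball_zero_iff.1 z.2).le⟩ z rfl⟩
  · rintro ⟨r, hr, h⟩
    filter_upwards [lt_mem_nhds hr] with s hs z hz
    exact h z (hz ▸ hs)

theorem zeroExt_eventuallyEq (F : Disc → ℂ) (G : ℂ → ℂ) (h : ∀ z : Disc, F z = G z) (z : Disc) :
    zeroExt F =ᶠ[𝓝 (z : ℂ)] G := by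
  filter_upwards [Metric.isOpen_ball.mem_nhds z.2] with w hw
  rw [zeroExt_of_mem _ hw, h]

/-- The element of `H(𝔻)` given by a function that is analytic on the disc. -/
noncomputable def HolD.ofDifferentiableOn (G : ℂ → ℂ) (hG : DifferentiableOn ℂ G Disc) : HolD :=
  ⟨⟨fun z => G z, hG.continuousOn.domRestrict⟩,
    hG.congr fun z hz => by
      rw [zeroExt_of_mem _ hz]; rfl⟩

theorem HolD.hasDerivAt (f : HolD) (z : Disc) : HasDerivAt (zeroExt f.val) (f.der z) z :=
  (f.differentiableAt z).hasDerivAt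

theorem HolD.der_eq_of_hasDerivAt {f : HolD} {G : ℂ → ℂ} (h : ∀ z : Disc, f.val z = G z)
    {z : Disc} {d : ℂ} (hG : HasDerivAt G d z) : f.der z = d :=
  (hG.congr_of_eventuallyEq (zeroExt_eventuallyEq _ _ h z)).deriv

theorem HolD.der_sub (f g : HolD) (z : Disc) : (f - g).der z = f.der z - g.der z := by
  rw [sub_eq_add_neg, ← neg_one_smul ℂ g, HolD.der_add, HolD.der_smul]; ring

theorem HolD.differentiableOn_der (f : HolD) : DifferentiableOn ℂ (zeroExt f.der) Disc :=
  (DifferentiableOn.deriv f.isHol Metric.isOpen_ball).congr fun z hz => by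
    rw [zeroExt_of_mem _ hz]; rfl

theorem exists_norm_le_of_differentiableOn {F : ℂ → ℂ} (hF : DifferentiableOn ℂ F Disc) {r : ℝ}
    (hr : r < 1) : ∃ M, 0 < M ∧ ∀ z : ℂ, ‖z‖ ≤ r → ‖F z‖ ≤ M := by
  obtain ⟨M, hM⟩ := (isCompact_closedBall (0 : ℂ) r).exists_bound_of_continuousOn
    (hF.continuousOn.mono (Metric.closedBall_subset_ball hr))
  exact ⟨max M 1, by positivity,
    fun z hz => (hM z (mem_closedBall_zero_iff.2 hz)).trans (le_max_left _ _)⟩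

theorem HolD.exists_norm_val_le (f : HolD) {r : ℝ} (hr : r < 1) :
    ∃ M, 0 < M ∧ ∀ z : Disc, ‖(z : ℂ)‖ ≤ r → ‖f.val z‖ ≤ M := by
  obtain ⟨M, h0, hM⟩ := exists_norm_le_of_differentiableOn f.isHol hr
  exact ⟨M, h0, fun z hz => by simpa only [zeroExt_coe] using hM z hz⟩

theorem HolD.exists_norm_der_le (f : HolD) {r : ℝ} (hr : r < 1) :
    ∃ M, 0 < M ∧ ∀ z : Disc, ‖(z : ℂ)‖ ≤ r → ‖f.der z‖ ≤ M := by
  obtain ⟨M, h0, hM⟩ := exists_norm_le_of_differentiableOn f.differentiableOn_der hr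
  exact ⟨M, h0, fun z hz => by simpa only [zeroExt_coe] using hM z hz⟩

/-- Cauchy's estimate on the discs that are concentric with `z` and half as large as possible. -/
theorem HolD.norm_der_le (f : HolD) (z : Disc) {C : ℝ}
    (hC : ∀ w : Disc, ‖(w : ℂ)‖ ≤ (1 + ‖(z : ℂ)‖) / 2 → ‖f.val w‖ ≤ C) :
    (1 - ‖(z : ℂ)‖) * ‖f.der z‖ ≤ 2 * C := by
  have hz : ‖(z : ℂ)‖ < 1 := mem_ball_zero_iff.1 z.2
  have hR : 0 < (1 - ‖(z : ℂ)‖) / 2 := by linarith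
  have hle : ∀ w ∈ Metric.closedBall (z : ℂ) ((1 - ‖(z : ℂ)‖) / 2),
      ‖w‖ ≤ (1 + ‖(z : ℂ)‖) / 2 := fun w hw => by
    have := norm_le_norm_add_norm_sub' w (z : ℂ)
    rw [mem_closedBall_iff_norm] at hw
    linarith
  have hsub : Metric.closedBall (z : ℂ) ((1 - ‖(z : ℂ)‖) / 2) ⊆ Disc := fun w hw =>
    mem_ball_zero_iff.2 (by linarith [hle w hw])
  have key := Complex.norm_deriv_le_of_forall_mem_sphere_norm_le hR
    (DifferentiableOn.diffContOnCl_ball f.isHol hsub) (C := C) fun w hw => by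
      have hw' := Metric.sphere_subset_closedBall hw
      rw [zeroExt_of_mem _ (hsub hw')]
      exact hC _ (hle w hw')
  rw [le_div_iff₀ hR] at key
  have : ‖f.der z‖ * ((1 - ‖(z : ℂ)‖) / 2) ≤ C := key
  linarith

/-! ### Selfmaps and the Volterra operator -/

/-- A selfmap of the disc as an element of `H(𝔻)`. -/
noncomputable def SelfMap.toHol (φ : SelfMap) : HolD :=
  HolD.ofDifferentiableOn (zeroExt fun z => (φ.toFun z : ℂ)) φ.isHol

theorem SelfMap.toHol_val (φ : SelfMap) (z : Disc) : φ.toHol.val z = φ.toFun z :=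
  zeroExt_coe (fun w => (φ.toFun w : ℂ)) z

theorem SelfMap.norm_lt_one (φ : SelfMap) (z : Disc) : ‖(φ.toFun z : ℂ)‖ < 1 :=
  mem_ball_zero_iff.1 (φ.toFun z).2

/-- Cauchy's estimate with `|φ| ≤ 1`: a crude substitute for Schwarz–Pick, sufficient because the
constant plays no role. -/
theorem SelfMap.norm_der_le (φ : SelfMap) (z : Disc) :
    (1 - ‖(z : ℂ)‖) * ‖φ.toHol.der z‖ ≤ 2 := by
  simpa using φ.toHol.norm_der_le z (C := 1) fun w _ => by
    rw [φ.toHol_val]; exact (φ.norm_lt_one w).le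

theorem HasDerivAt.comp_selfMap {H : ℂ → ℂ} {d : ℂ} (φ : SelfMap) (z : Disc)
    (hH : HasDerivAt H d (φ.toFun z)) :
    HasDerivAt (fun w => H (zeroExt φ.toHol.val w)) (d * φ.toHol.der z) z := by
  refine HasDerivAt.comp (z : ℂ) ?_ (φ.toHol.hasDerivAt z)
  rwa [zeroExt_coe, φ.toHol_val]

theorem HolD.comp_val (g : HolD) (φ : SelfMap) (z : Disc) :
    (g.comp φ).val z = g.val (φ.toFun z) := rfl

theorem HolD.comp_der (g : HolD) (φ : SelfMap) (z : Disc) :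
    (g.comp φ).der z = g.der (φ.toFun z) * φ.toHol.der z :=
  HolD.der_eq_of_hasDerivAt
    (fun w => by rw [g.comp_val, zeroExt_coe, φ.toHol_val, zeroExt_coe])
    (HasDerivAt.comp_selfMap φ z (g.hasDerivAt (φ.toFun z)))

theorem integral_segment_eq_sub {H h : ℂ → ℂ} (hH : ∀ w ∈ Disc, HasDerivAt H (h w) w)
    (hh : ContinuousOn h Disc) {w : ℂ} (hw : w ∈ Disc) :
    ∫ t in (0 : ℝ)..1, h (t * w) * w = H w - H 0 := by
  have hmem : ∀ t ∈ Set.uIcc (0 : ℝ) 1, (t : ℂ) * w ∈ Disc := fun t ht => by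
    rw [Set.uIcc_of_le zero_le_one] at ht
    rw [mem_ball_zero_iff] at hw ⊢
    rw [norm_mul, Complex.norm_real, Real.norm_of_nonneg ht.1]
    exact (mul_le_of_le_one_left (norm_nonneg _) ht.2).trans_lt hw
  have hd : ∀ t ∈ Set.uIcc (0 : ℝ) 1,
      HasDerivAt (fun s : ℝ => H (s * w)) (h (t * w) * w) t := fun t ht => by
    have h1 : HasDerivAt (fun s : ℝ => (s : ℂ) * w) w t := by
      simpa using (Complex.ofRealCLM.hasDerivAt (x := t)).mul_const w
    exact HasDerivAt.comp t (hH _ (hmem t ht)) h1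
  rw [intervalIntegral.integral_eq_sub_of_hasDerivAt hd]
  · simp
  · apply ContinuousOn.intervalIntegrable
    refine ContinuousOn.mul (hh.comp (by fun_prop) hmem) continuousOn_const

/-- `f g'` has a primitive `H` on the disc. Writing the integral as `H ∘ φ - H 0` avoids
differentiating under the integral sign. -/
theorem exists_primitive_volterra (g f : HolD) (φ : SelfMap) :
    ∃ H : ℂ → ℂ, (∀ w : Disc, HasDerivAt H (f.val w * g.der w) w) ∧
      ∀ z, volterra g φ f z = H (φ.toFun z) - H 0 := by
  have hd : DifferentiableOn ℂ (fun w => zeroExt f.val w * zeroExt g.der w) Disc :=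
    DifferentiableOn.mul f.isHol g.differentiableOn_der
  obtain ⟨H, hH⟩ := hd.isExactOn_ball
  refine ⟨H, fun w => by simpa only [zeroExt_coe] using hH w w.2, fun z => ?_⟩
  exact integral_segment_eq_sub hH hd.continuousOn (φ.toFun z).2

/-- `(T_g^φ f)' = (f ∘ φ) (g ∘ φ)'`. -/
theorem der_of_val_eq_volterra {g f F : HolD} {φ : SelfMap} (hF : ∀ z, F.val z = volterra g φ f z)
    (z : Disc) : F.der z = f.val (φ.toFun z) * (g.comp φ).der z := by
  obtain ⟨H, hH, hV⟩ := exists_primitive_volterra g f φ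
  rw [g.comp_der, ← mul_assoc]
  refine HolD.der_eq_of_hasDerivAt (G := fun w => H (zeroExt φ.toHol.val w) - H 0) (fun w => ?_)
    ((HasDerivAt.comp_selfMap φ z (hH (φ.toFun z))).sub_const _)
  rw [hF, hV, zeroExt_coe, φ.toHol_val]

end VolterraDisc

namespace VolterraDisc

/-! ### The little weighted spaces -/

theorem tendsto_weight_of_approx (v : Weight) {a : Disc → ℂ}
    (h : ∀ ε > 0, ∃ b : Disc → ℂ, Tendsto (fun z => v z * ‖b z‖) toBoundary (𝓝 0) ∧
      ∀ z, v z * ‖a z - b z‖ ≤ ε) :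
    Tendsto (fun z => v z * ‖a z‖) toBoundary (𝓝 0) := by
  rw [Metric.tendsto_nhds]
  intro ε hε
  obtain ⟨b, hb, hab⟩ := h (ε / 2) (half_pos hε)
  filter_upwards [hb.eventually (gt_mem_nhds (half_pos hε))] with z hz
  have h1 := mul_le_mul_of_nonneg_left (norm_le_norm_add_norm_sub' (a z) (b z)) (v.pos z).le
  rw [mul_add] at h1
  rw [dist_zero_right, Real.norm_of_nonneg (mul_nonneg (v.pos z).le (norm_nonneg _))]
  linarith [hab z]

theorem HvInf.weight_mul_norm_val_le {v : Weight} (f : HvInf v) (z : Disc) :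
    v z * ‖(HvInf.incl v f).val z‖ ≤ ‖f‖ := le_ciSup f.2 z

theorem BvInf.weight_mul_norm_der_le {v : Weight} (f : BvInf v) (z : Disc) :
    v z * ‖(BvInf.incl v f).der z‖ ≤ ‖f‖ :=
  (le_ciSup f.2 z).trans (le_add_of_nonneg_left (norm_nonneg _))

theorem isClosed_Hv0 (v : Weight) : IsClosed (Hv0 v : Set (HvInf v)) := by
  refine isClosed_of_closure_subset fun f hf => tendsto_weight_of_approx v fun ε hε => ?_
  obtain ⟨b, hb, hfb⟩ := Metric.mem_closure_iff.1 hf ε hε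
  refine ⟨(HvInf.incl v b).val, hb, fun z => ?_⟩
  rw [dist_eq_norm] at hfb
  exact ((f - b).weight_mul_norm_val_le z).trans hfb.le

theorem isClosed_Bv0 (v : Weight) : IsClosed (Bv0 v : Set (BvInf v)) := by
  refine isClosed_of_closure_subset fun f hf => tendsto_weight_of_approx v fun ε hε => ?_
  obtain ⟨b, hb, hfb⟩ := Metric.mem_closure_iff.1 hf ε hε
  refine ⟨(BvInf.incl v b).der, hb, fun z => ?_⟩
  rw [dist_eq_norm] at hfb
  have h := ((f - b).weight_mul_norm_der_le z).trans hfb.le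
  rwa [map_sub, HolD.der_sub] at h

theorem tendsto_of_weight_mul_norm_sub_le {α Y : Type*} [NormedAddCommGroup Y] {l : Filter α}
    {c : ℝ} (hc : 0 < c) {D : Y → ℂ} {C : ℝ} (hD : ∀ x y, c * ‖D x - D y‖ ≤ C * ‖x - y‖)
    {u : α → Y} {y : Y} (hu : Tendsto u l (𝓝 y)) : Tendsto (fun i => D (u i)) l (𝓝 (D y)) := by
  rw [tendsto_iff_norm_sub_tendsto_zero] at hu ⊢
  refine squeeze_zero (fun _ => norm_nonneg _) (fun i => ?_) (by simpa using hu.const_mul (C / c))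
  rw [div_mul_eq_mul_div, le_div_iff₀ hc, mul_comm]
  exact hD _ _

theorem BvInf.tendsto_der {α : Type*} {l : Filter α} {v : Weight} {u : α → BvInf v} {h : BvInf v}
    (hu : Tendsto u l (𝓝 h)) (z : Disc) :
    Tendsto (fun i => (BvInf.incl v (u i)).der z) l (𝓝 ((BvInf.incl v h).der z)) :=
  tendsto_of_weight_mul_norm_sub_le (D := fun f => (BvInf.incl v f).der z) (C := 1) (v.pos z)
    (fun x y => by
      rw [one_mul, ← HolD.der_sub, ← map_sub]
      exact (x - y).weight_mul_norm_der_le z) hu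

/-! ### Compact operators into subspaces -/

section Compact

variable {X Y : Type*} [NormedAddCommGroup X] [NormedSpace ℂ X] [NormedAddCommGroup Y]
  [NormedSpace ℂ Y]

theorem exists_subseq_tendsto_of_isCompactOperator {S : X →ₗ[ℂ] Y} (hS : IsCompactOperator S)
    {x : ℕ → X} {R : ℝ} (hx : ∀ n, ‖x n‖ ≤ R) :
    ∃ σ : ℕ → ℕ, StrictMono σ ∧ ∃ y, Tendsto (fun n => S (x (σ n))) atTop (𝓝 y) := by
  obtain ⟨K, hK, hSK⟩ := hS.image_closedBall_subset_compact R
  obtain ⟨y, -, σ, hσ, hy⟩ := hK.tendsto_subseq (x := fun n => S (x n)) fun n =>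
    hSK ⟨x n, mem_closedBall_zero_iff.2 (hx n), rfl⟩
  exact ⟨σ, hσ, y, hy⟩

variable {ι : X →ₗ[ℂ] HolD} {κ : Y →ₗ[ℂ] HolD} {V : Submodule ℂ Y} {T : HolD → Disc → ℂ}

theorem IsCompactBetween.of_submodule (h : IsCompactBetween ι (κ ∘ₗ V.subtype) T) :
    IsCompactBetween ι κ T := by
  obtain ⟨S, hS, hc⟩ := h
  exact ⟨V.subtype ∘ₗ S, hS, hc.continuous_comp continuous_subtype_val⟩

/-- Closedness of `V` keeps the intersection of a compact set with `V` compact. What remains is the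
pointwise membership `hmem`, where compactness of `S` may be used again. -/
theorem IsCompactBetween.to_submodule (hV : IsClosed (V : Set Y)) (h : IsCompactBetween ι κ T)
    (hmem : ∀ S : X →ₗ[ℂ] Y, (∀ f z, (κ (S f)).val z = T (ι f) z) → IsCompactOperator S →
      ∀ f, S f ∈ V) :
    IsCompactBetween ι (κ ∘ₗ V.subtype) T := by
  obtain ⟨S, hS, hc⟩ := h
  exact ⟨S.codRestrict V (hmem S hS hc), hS, hc.codRestrict (hmem S hS hc) hV⟩

end Compact

/-! ### Bloch-type spaces as the range -/

section Bloch

variable {X : Type*} [NormedAddCommGroup X] [NormedSpace ℂ X] {ι : X →ₗ[ℂ] HolD} {g : HolD}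
  {φ : SelfMap} {v : Weight}

/-- Decay at the boundary already forces the supremum to be finite, so membership in `B_v^0` is a
statement about the decay of `v |f'|` alone. -/
theorem mem_range_Bv0_incl {f : HolD} :
    f ∈ LinearMap.range (Bv0.incl v) ↔ Tendsto (fun z => v z * ‖f.der z‖) toBoundary (𝓝 0) := by
  constructor
  · rintro ⟨b, rfl⟩
    exact b.2
  · intro h
    have hb : BddAbove (Set.range fun z => v z * ‖f.der z‖) := by
      obtain ⟨r, hr, hr'⟩ := eventually_toBoundary.1 (h.eventually (gt_mem_nhds one_pos))
      obtain ⟨M, hM0, hM⟩ := f.exists_norm_der_le hr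
      -- A general weight need not be monotone; its bound on `|z| ≤ r` comes from compactness.
      have hv : ∃ B, 0 ≤ B ∧ ∀ z : Disc, ‖(z : ℂ)‖ ≤ r → v z ≤ B := by
        have hK : IsCompact {z : Disc | ‖(z : ℂ)‖ ≤ r} := by
          rw [Subtype.isCompact_iff]
          convert isCompact_closedBall (0 : ℂ) r using 1
          ext w
          constructor
          · rintro ⟨z, hz, rfl⟩
            exact mem_closedBall_zero_iff.2 hz
          · intro hw
            have hw' := mem_closedBall_zero_iff.1 hw
            exact ⟨⟨w, mem_ball_zero_iff.2 (hw'.trans_lt hr)⟩, hw', rfl⟩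
        obtain ⟨B, hB⟩ := hK.exists_bound_of_continuousOn v.continuous.continuousOn
        exact ⟨max B 0, le_max_right _ _, fun z hz =>
          ((le_abs_self _).trans (hB z hz)).trans (le_max_left _ _)⟩
      obtain ⟨B, hB0, hB⟩ := hv
      refine ⟨max 1 (B * M), ?_⟩
      rintro _ ⟨z, rfl⟩
      rcases lt_or_ge r ‖(z : ℂ)‖ with hz | hz
      · exact (hr' z hz).le.trans (le_max_left _ _)
      · exact (mul_le_mul (hB z hz) (hM z hz) (norm_nonneg _) hB0).trans (le_max_right _ _)
    exact ⟨⟨⟨f, hb⟩, h⟩, rfl⟩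

theorem comp_mem_range_Bv0_incl (hconst : ContainsConstants ι)
    (h : IsCompactBetween ι (Bv0.incl v) (volterra g φ)) :
    g.comp φ ∈ LinearMap.range (Bv0.incl v) := by
  obtain ⟨S, hS, -⟩ := h
  obtain ⟨e, he⟩ := hconst 1
  have hd : ∀ z, (Bv0.incl v (S e)).der z = (g.comp φ).der z := fun z => by
    rw [der_of_val_eq_volterra (hS e), he, one_mul]
  have := mem_range_Bv0_incl.1 ⟨S e, rfl⟩
  simp only [hd] at this
  exact mem_range_Bv0_incl.2 this

theorem mem_Bv0_of_isCompactOperator (hIV : CondIV ι) {S : X →ₗ[ℂ] BvInf v}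
    (hS : ∀ f z, (BvInf.incl v (S f)).val z = volterra g φ (ι f) z) (hc : IsCompactOperator S)
    (hg : g.comp φ ∈ LinearMap.range (Bv0.incl v)) (f : X) : S f ∈ Bv0 v := by
  rw [mem_range_Bv0_incl] at hg
  obtain ⟨C, hC⟩ := hIV
  -- The exponent `n + 1` excludes the radius `0`, which (IV) does not cover.
  have hr : ∀ n : ℕ, (1 - (2⁻¹ : ℝ) ^ (n + 1)) ∈ Set.Ioo (0 : ℝ) 1 := fun n => by
    have h1 : (2⁻¹ : ℝ) ^ (n + 1) < 1 := pow_lt_one₀ (by norm_num) (by norm_num) (by omega)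
    have h2 : (0 : ℝ) < 2⁻¹ ^ (n + 1) := by positivity
    constructor <;> linarith
  choose T hT hTC using fun n => hC _ (hr n)
  have hder : ∀ n z, (BvInf.incl v (S (T n f))).der z =
      zeroExt (ι f).val ((1 - (2⁻¹ : ℝ) ^ (n + 1) : ℝ) * φ.toFun z) * (g.comp φ).der z :=
    fun n z => by rw [der_of_val_eq_volterra (hS _), hT]
  have hmem : ∀ n, S (T n f) ∈ Bv0 v := fun n => by
    obtain ⟨M, -, hM⟩ := exists_norm_le_of_differentiableOn (ι f).isHol (hr n).2
    refine squeeze_zero (fun z => mul_nonneg (v.pos z).le (norm_nonneg _)) (fun z => ?_)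
      (by simpa using hg.const_mul M)
    have hle := hM ((1 - (2⁻¹ : ℝ) ^ (n + 1) : ℝ) * φ.toFun z) (by
      rw [norm_mul, Complex.norm_real, Real.norm_of_nonneg (hr n).1.le]
      exact mul_le_of_le_one_right (hr n).1.le (φ.norm_lt_one z).le)
    rw [hder, norm_mul]
    have := mul_le_mul_of_nonneg_right hle
      (mul_nonneg (v.pos z).le (norm_nonneg ((g.comp φ).der z)))
    linarith
  obtain ⟨σ, hσ, h, hh⟩ := exists_subseq_tendsto_of_isCompactOperator hc
    (x := fun n => T n f) (R := C * ‖f‖) fun n =>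
      ((T n).le_opNorm f).trans (mul_le_mul_of_nonneg_right (hTC n) (norm_nonneg f))
  have hh0 : h ∈ Bv0 v := (isClosed_Bv0 v).mem_of_tendsto hh (.of_forall fun n => hmem _)
  -- Equality of derivatives suffices; `h = S f` itself is not needed for membership in `B_v^0`.
  have heq : ∀ z, (BvInf.incl v h).der z = (BvInf.incl v (S f)).der z := fun z => by
    refine tendsto_nhds_unique (BvInf.tendsto_der hh z) ?_
    rw [der_of_val_eq_volterra (hS f)]
    simp only [hder]
    refine Tendsto.mul_const _ ?_
    have hlim : Tendsto (fun n : ℕ => (1 - (2⁻¹ : ℝ) ^ (n + 1))) atTop (𝓝 1) := by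
      simpa using ((tendsto_pow_atTop_nhds_zero_of_lt_one (r := (2⁻¹ : ℝ)) (by norm_num)
        (by norm_num)).comp (tendsto_add_atTop_nat 1)).const_sub 1
    have hlim' : Tendsto (fun n : ℕ => ((1 - (2⁻¹ : ℝ) ^ (n + 1) : ℝ) : ℂ) * φ.toFun z) atTop
        (𝓝 (φ.toFun z : ℂ)) := by
      simpa using ((Complex.continuous_ofReal.tendsto _).comp hlim).mul_const (φ.toFun z : ℂ)
    have hcont := ((ι f).differentiableAt (φ.toFun z)).continuousAt.tendsto
    rw [zeroExt_coe] at hcont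
    exact hcont.comp (hlim'.comp hσ.tendsto_atTop)
  change Tendsto _ _ _ at hh0
  simp only [heq] at hh0
  exact hh0

end Bloch

end VolterraDisc

namespace VolterraDisc

/-! ### Normal weights -/

theorem norm_dyadicPt (n : ℕ) : ‖(dyadicPt n : ℂ)‖ = 1 - (2⁻¹ : ℝ) ^ n := by
  have h2 : (2⁻¹ : ℝ) ^ n ≤ 1 := pow_le_one₀ (by norm_num) (by norm_num)
  rw [dyadicPt, Complex.norm_real, Real.norm_of_nonneg (by linarith)]

theorem norm_dyadicPt_lt_one (n : ℕ) : ‖(dyadicPt n : ℂ)‖ < 1 := mem_ball_zero_iff.1 (dyadicPt n).2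

theorem strictMono_norm_dyadicPt : StrictMono fun n => ‖(dyadicPt n : ℂ)‖ := fun m n h => by
  simp only [norm_dyadicPt]
  have := pow_lt_pow_right_of_lt_one₀ (by norm_num : (0 : ℝ) < 2⁻¹) (by norm_num) h
  linarith

theorem tendsto_norm_dyadicPt : Tendsto (fun n => ‖(dyadicPt n : ℂ)‖) atTop (𝓝 1) := by
  simp only [norm_dyadicPt]
  simpa using (tendsto_pow_atTop_nhds_zero_of_lt_one (r := (2⁻¹ : ℝ)) (by norm_num)
    (by norm_num)).const_sub 1

theorem tendsto_dyadicPt : Tendsto dyadicPt atTop toBoundary :=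
  tendsto_comap_iff.2 tendsto_norm_dyadicPt

theorem exists_dyadicPt_le_norm_lt (z : Disc) :
    ∃ n, ‖(dyadicPt n : ℂ)‖ ≤ ‖(z : ℂ)‖ ∧ ‖(z : ℂ)‖ < ‖(dyadicPt (n + 1) : ℂ)‖ := by
  have hz : ‖(z : ℂ)‖ < 1 := mem_ball_zero_iff.1 z.2
  obtain ⟨n, h1, h2⟩ := exists_nat_pow_near_of_lt_one (x := 1 - ‖(z : ℂ)‖) (y := (2⁻¹ : ℝ))
    (by linarith) (by linarith [norm_nonneg (z : ℂ)]) (by norm_num) (by norm_num)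
  refine ⟨n, ?_, ?_⟩ <;> rw [norm_dyadicPt] <;> linarith

namespace Weight.IsNormal

variable {v : Weight}

theorem antitone_dyadic (hv : v.IsNormal) : Antitone fun n => v (dyadicPt n) := fun _ _ h =>
  hv.antitone _ _ (strictMono_norm_dyadicPt.monotone h)

theorem exists_doubling (hv : v.IsNormal) :
    ∃ D : ℝ, 0 < D ∧ ∀ n, v (dyadicPt n) ≤ D * v (dyadicPt (n + 1)) := by
  obtain ⟨D, hD⟩ := hv.sup_finite
  have h : ∀ n, v (dyadicPt n) ≤ D * v (dyadicPt (n + 1)) := fun n =>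
    (div_le_iff₀ (v.pos _)).1 (hD ⟨n, rfl⟩)
  exact ⟨D, pos_of_mul_pos_left ((v.pos _).trans_le (h 0)) (v.pos _).le, h⟩

theorem exists_contraction (hv : v.IsNormal) :
    ∃ k : ℕ, ∃ q < (1 : ℝ), ∃ N : ℕ, ∀ n ≥ N, v (dyadicPt (n + k)) ≤ q * v (dyadicPt n) := by
  obtain ⟨k, hk⟩ := exists_lt_of_ciInf_lt hv.limsup_lt
  obtain ⟨q, hkq, hq⟩ := exists_between hk
  have hb : atTop.IsBoundedUnder (· ≤ ·)
      (fun n : ℕ => v (dyadicPt (n + k)) / v (dyadicPt n)) :=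
    isBoundedUnder_of ⟨1, fun n =>
      (div_le_one (v.pos _)).2 (hv.antitone_dyadic (Nat.le_add_right n k))⟩
  obtain ⟨N, hN⟩ := eventually_atTop.1 (eventually_lt_of_limsup_lt hkq hb)
  exact ⟨k, q, hq, N, fun n hn => ((div_lt_iff₀ (v.pos _)).1 (hN n hn)).le⟩

end Weight.IsNormal

/-- Geometric decay along steps of length `k` makes the last terms dominate the sum: the left side
`s n` satisfies `s (n + k) ≤ q * s n + k`, since each of the `k` new terms contributes at most `1`
by monotonicity. -/
theorem exists_mul_sum_inv_le {a : ℕ → ℝ} (ha : ∀ n, 0 < a n) (hanti : Antitone a) {k N : ℕ}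
    {q : ℝ} (hq : q < 1) (hk : ∀ n ≥ N, a (n + k) ≤ q * a n) :
    ∃ C, 0 < C ∧ ∀ n, a n * ∑ j ∈ Finset.range (n + 1), (a j)⁻¹ ≤ C := by
  have hq0 : 0 ≤ q :=
    (pos_of_mul_pos_left ((ha _).trans_le (hk N le_rfl)) (ha N).le).le
  have hk0 : 0 < k := by
    rcases Nat.eq_zero_or_pos k with rfl | h
    · have h1 : a N ≤ q * a N := hk N le_rfl
      nlinarith [ha N]
    · exact h
  set s : ℕ → ℝ := fun n => a n * ∑ j ∈ Finset.range (n + 1), (a j)⁻¹ with hs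
  have hs0 : ∀ n, 0 ≤ s n := fun n =>
    mul_nonneg (ha n).le (Finset.sum_nonneg fun j _ => (inv_pos.2 (ha j)).le)
  have hstep : ∀ n ≥ N, s (n + k) ≤ q * s n + k := fun n hn => by
    have h1 : s (n + k) = a (n + k) * ∑ j ∈ Finset.range (n + 1), (a j)⁻¹ +
        ∑ j ∈ Finset.range k, a (n + k) * (a (n + 1 + j))⁻¹ := by
      simp only [hs]
      rw [← Finset.mul_sum, ← mul_add, ← Finset.sum_range_add, Nat.add_right_comm]
    have h2 : a (n + k) * ∑ j ∈ Finset.range (n + 1), (a j)⁻¹ ≤ q * s n := by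
      simp only [hs]
      rw [← mul_assoc]
      exact mul_le_mul_of_nonneg_right (hk n hn)
        (Finset.sum_nonneg fun j _ => (inv_pos.2 (ha j)).le)
    have h3 : ∑ j ∈ Finset.range k, a (n + k) * (a (n + 1 + j))⁻¹ ≤ k := by
      have : ∑ j ∈ Finset.range k, a (n + k) * (a (n + 1 + j))⁻¹ ≤
          ∑ _j ∈ Finset.range k, (1 : ℝ) := Finset.sum_le_sum fun j hj => by
        rw [← div_eq_mul_inv, div_le_one (ha _)]
        have := Finset.mem_range.1 hj
        exact hanti (by omega)
      simpa using this
    linarith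
  -- The sum covers the initial values, `k / (1 - q)` gives `q * C + k ≤ C` for the induction, and
  -- `1` makes `C` positive.
  set C := ∑ j ∈ Finset.range (N + k), s j + k / (1 - q) + 1 with hC
  have hdiv : 0 ≤ (k : ℝ) / (1 - q) := div_nonneg k.cast_nonneg (by linarith)
  have hsum : 0 ≤ ∑ j ∈ Finset.range (N + k), s j := Finset.sum_nonneg fun j _ => hs0 j
  refine ⟨C, by linarith, fun n => ?_⟩
  induction n using Nat.strong_induction_on with
  | _ n ih =>
    rcases lt_or_ge n (N + k) with h | h
    · have := Finset.single_le_sum (fun j _ => hs0 j) (Finset.mem_range.2 h)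
      change s n ≤ C
      linarith
    · obtain ⟨m, rfl⟩ : ∃ m, n = m + k := ⟨n - k, by omega⟩
      have h1 := hstep m (by omega)
      have h2 : s m ≤ C := ih m (by omega)
      have h3 : (k : ℝ) ≤ (1 - q) * C := by
        have : (k : ℝ) / (1 - q) ≤ C := by linarith
        rwa [div_le_iff₀ (by linarith), mul_comm] at this
      change s (m + k) ≤ C
      nlinarith [mul_le_mul_of_nonneg_left h2 hq0]

/-- For a normal weight, `f ↦ f'` is bounded from `H_v^∞` to the weighted space with weight
`(1 - |z|) v(z)`. -/
theorem Weight.IsNormal.exists_mul_norm_der_le {v : Weight} (hv : v.IsNormal) :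
    ∃ C, 0 < C ∧ ∀ (f : HvInf v) (z : Disc),
      (1 - ‖(z : ℂ)‖) * v z * ‖(HvInf.incl v f).der z‖ ≤ C * ‖f‖ := by
  obtain ⟨D, hD0, hD⟩ := hv.exists_doubling
  refine ⟨2 * (D * D), by positivity, fun f z => ?_⟩
  obtain ⟨n, h1, h2⟩ := exists_dyadicPt_le_norm_lt z
  -- Halving the distance to the boundary costs one dyadic step and locating `z` in its shell
  -- another, hence two doublings.
  have hle : ∀ w : Disc, ‖(w : ℂ)‖ ≤ (1 + ‖(z : ℂ)‖) / 2 → v z ≤ D * D * v w := fun w hw => by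
    have hw' : ‖(w : ℂ)‖ ≤ ‖(dyadicPt (n + 2) : ℂ)‖ := by
      rw [norm_dyadicPt] at h2 ⊢
      rw [pow_succ] at h2 ⊢
      rw [pow_succ]
      linarith
    calc v z ≤ v (dyadicPt n) := hv.antitone _ _ h1
      _ ≤ D * v (dyadicPt (n + 1)) := hD n
      _ ≤ D * (D * v (dyadicPt (n + 2))) := mul_le_mul_of_nonneg_left (hD (n + 1)) hD0.le
      _ = D * D * v (dyadicPt (n + 2)) := by ring
      _ ≤ D * D * v w := mul_le_mul_of_nonneg_left (hv.antitone _ _ hw') (by positivity)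
  have key := (HvInf.incl v f).norm_der_le z (C := D * D * ‖f‖ / v z) fun w hw => by
    rw [le_div_iff₀ (v.pos z)]
    have h3 := mul_le_mul_of_nonneg_left (hle w hw) (norm_nonneg ((HvInf.incl v f).val w))
    have h4 := mul_le_mul_of_nonneg_left (f.weight_mul_norm_val_le w)
      (mul_pos hD0 hD0).le
    linarith
  have h5 := mul_le_mul_of_nonneg_left key (v.pos z).le
  have h6 : v z * (2 * (D * D * ‖f‖ / v z)) = 2 * (D * D) * ‖f‖ := by
    have := (v.pos z).ne'
    field_simp
  linarith

theorem HvInf.tendsto_der {α : Type*} {l : Filter α} {v : Weight} (hv : v.IsNormal)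
    {u : α → HvInf v} {h : HvInf v} (hu : Tendsto u l (𝓝 h)) (z : Disc) :
    Tendsto (fun i => (HvInf.incl v (u i)).der z) l (𝓝 ((HvInf.incl v h).der z)) := by
  obtain ⟨C, -, hC⟩ := hv.exists_mul_norm_der_le
  have hz : ‖(z : ℂ)‖ < 1 := mem_ball_zero_iff.1 z.2
  exact tendsto_of_weight_mul_norm_sub_le (D := fun f => (HvInf.incl v f).der z) (C := C)
    (mul_pos (sub_pos.2 hz) (v.pos z))
    (fun x y => by rw [← HolD.der_sub, ← map_sub]; exact hC (x - y) z) hu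

/-! ### From the growth of the derivative back to the growth of the function -/

theorem HolD.norm_val_le_of_norm_der_le (f : HolD) {z : Disc} {ρ A C : ℝ} (hρ : 0 ≤ ρ)
    (hz0 : 0 < ‖(z : ℂ)‖) (hz : ρ ≤ ‖(z : ℂ)‖)
    (hA : ∀ w : Disc, ‖(w : ℂ)‖ ≤ ρ → ‖f.val w‖ ≤ A)
    (hC : ∀ w : Disc, ρ ≤ ‖(w : ℂ)‖ → ‖(w : ℂ)‖ ≤ ‖(z : ℂ)‖ → ‖f.der w‖ ≤ C) :
    ‖f.val z‖ ≤ A + C * (‖(z : ℂ)‖ - ρ) := by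
  have hz1 : ‖(z : ℂ)‖ < 1 := mem_ball_zero_iff.1 z.2
  -- `τ z` is where the radius through `z` meets `|w| = ρ`; the mean value inequality is applied
  -- from there to `z`.
  set τ := ρ / ‖(z : ℂ)‖ with hτ
  have hτ0 : 0 ≤ τ := div_nonneg hρ hz0.le
  have hτ1 : τ ≤ 1 := (div_le_one hz0).2 hz
  have hτz : τ * ‖(z : ℂ)‖ = ρ := div_mul_cancel₀ _ hz0.ne'
  have hnorm : ∀ s ∈ Set.Icc τ 1, ‖(s : ℂ) * z‖ = s * ‖(z : ℂ)‖ := fun s hs => by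
    rw [norm_mul, Complex.norm_real, Real.norm_of_nonneg (hτ0.trans hs.1)]
  have hmem : ∀ s ∈ Set.Icc τ 1, (s : ℂ) * z ∈ Disc := fun s hs => by
    rw [mem_ball_zero_iff, hnorm s hs]
    exact (mul_le_of_le_one_left hz0.le hs.2).trans_lt hz1
  have key := norm_image_sub_le_of_norm_deriv_le_segment' (a := τ) (b := 1)
    (f := fun s : ℝ => zeroExt f.val ((s : ℂ) * z))
    (f' := fun s : ℝ => deriv (zeroExt f.val) ((s : ℂ) * z) * z) (C := C * ‖(z : ℂ)‖)
    (fun s hs => by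
      have h1 : HasDerivAt (fun s : ℝ => (s : ℂ) * (z : ℂ)) z s := by
        simpa using (Complex.ofRealCLM.hasDerivAt (x := s)).mul_const (z : ℂ)
      exact (HasDerivAt.comp s (f.hasDerivAt ⟨_, hmem s hs⟩) h1).hasDerivWithinAt)
    (fun s hs => by
      have hs' := Set.Ico_subset_Icc_self hs
      rw [norm_mul]
      refine mul_le_mul_of_nonneg_right (hC ⟨_, hmem s hs'⟩ ?_ ?_) hz0.le
      · change ρ ≤ ‖(s : ℂ) * z‖
        rw [hnorm s hs', ← hτz]
        exact mul_le_mul_of_nonneg_right hs'.1 hz0.le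
      · change ‖(s : ℂ) * z‖ ≤ _
        rw [hnorm s hs']
        exact mul_le_of_le_one_left hz0.le hs'.2)
    1 ⟨hτ1, le_rfl⟩
  have hτmem := hmem τ ⟨le_rfl, hτ1⟩
  simp only [Complex.ofReal_one, one_mul, zeroExt_coe, zeroExt_of_mem _ hτmem] at key
  have h2 := hA ⟨_, hτmem⟩ (by
    change ‖(τ : ℂ) * z‖ ≤ ρ
    rw [hnorm τ ⟨le_rfl, hτ1⟩, hτz])
  have h3 := norm_le_norm_add_norm_sub' (f.val z) (f.val ⟨_, hτmem⟩)
  have h4 : C * ‖(z : ℂ)‖ * (1 - τ) = C * (‖(z : ℂ)‖ - ρ) := by rw [← hτz]; ring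
  linarith

/-- If `f'` is small in the weighted space with weight `(1 - |z|) v(z)`, then the growth of `f` on
the dyadic discs is controlled by the sum of the `1 / v(1 - 2^{-j})`. -/
theorem Weight.IsNormal.norm_val_le_sum {v : Weight} (hv : v.IsNormal) {f : HolD} {ε M : ℝ} {N : ℕ}
    (hε : 0 < ε)
    (hf : ∀ z : Disc, ‖(dyadicPt N : ℂ)‖ ≤ ‖(z : ℂ)‖ →
      (1 - ‖(z : ℂ)‖) * v z * ‖f.der z‖ ≤ ε)
    (hM : ∀ z : Disc, ‖(z : ℂ)‖ ≤ ‖(dyadicPt N : ℂ)‖ → ‖f.val z‖ ≤ M)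
    {n : ℕ} (hn : N ≤ n) (z : Disc) (hz : ‖(z : ℂ)‖ ≤ ‖(dyadicPt n : ℂ)‖) :
    ‖f.val z‖ ≤ M + ε * ∑ j ∈ Finset.range (n + 1), (v (dyadicPt j))⁻¹ := by
  induction n, hn using Nat.le_induction generalizing z with
  | base =>
    have : 0 ≤ ε * ∑ j ∈ Finset.range (N + 1), (v (dyadicPt j))⁻¹ :=
      mul_nonneg hε.le (Finset.sum_nonneg fun j _ => (inv_pos.2 (v.pos _)).le)
    linarith [hM z hz]
  | succ n hn ih =>
    rw [Finset.sum_range_succ, mul_add, ← add_assoc]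
    have hpos : 0 ≤ ε * (v (dyadicPt (n + 1)))⁻¹ := mul_nonneg hε.le (inv_pos.2 (v.pos _)).le
    rcases le_or_gt ‖(z : ℂ)‖ ‖(dyadicPt n : ℂ)‖ with h | h
    · linarith [ih z h]
    have hp : (0 : ℝ) < 2⁻¹ ^ (n + 1) := by positivity
    -- On this shell `1 - |w| ≥ 2^{-(n+1)}`, which is also the width of the shell, so the powers of
    -- two cancel and the shell contributes at most `ε / v(1 - 2^{-(n+1)})`.
    have key := f.norm_val_le_of_norm_der_le (norm_nonneg _) ((norm_nonneg _).trans_lt h) h.le ih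
      (C := ε * (v (dyadicPt (n + 1)))⁻¹ / 2⁻¹ ^ (n + 1)) fun w hw1 hw2 => by
        have h1 := hf w ((strictMono_norm_dyadicPt.monotone hn).trans hw1)
        have h2 := hv.antitone _ _ (hw2.trans hz)
        have h3 : (2⁻¹ : ℝ) ^ (n + 1) ≤ 1 - ‖(w : ℂ)‖ := by
          have := hw2.trans hz
          rw [norm_dyadicPt] at this
          linarith
        rw [le_div_iff₀ hp, ← div_eq_mul_inv, le_div_iff₀ (v.pos _)]
        have h4 := mul_le_mul h3 h2 (v.pos _).le (hp.le.trans h3)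
        have h5 := mul_le_mul_of_nonneg_right h4 (norm_nonneg (f.der w))
        linarith
    have hd : ‖(z : ℂ)‖ - ‖(dyadicPt n : ℂ)‖ ≤ 2⁻¹ ^ (n + 1) := by
      rw [norm_dyadicPt] at hz ⊢
      rw [pow_succ] at hz ⊢
      linarith
    have h6 := mul_le_mul_of_nonneg_left hd (div_nonneg hpos hp.le)
    rw [div_mul_cancel₀ _ hp.ne'] at h6
    linarith

/-- Multiplying the bound of `norm_val_le_sum` by `v`, the fixed term `M` vanishes in the limit
because `v → 0`, and the sum stays bounded by `exists_mul_sum_inv_le`, with a small factor in front.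
-/
theorem Weight.IsNormal.tendsto_val_of_tendsto_der {v : Weight} (hv : v.IsNormal) {f : HolD}
    (hf : Tendsto (fun z : Disc => (1 - ‖(z : ℂ)‖) * v z * ‖f.der z‖) toBoundary (𝓝 0)) :
    Tendsto (fun z => v z * ‖f.val z‖) toBoundary (𝓝 0) := by
  obtain ⟨D, hD0, hD⟩ := hv.exists_doubling
  obtain ⟨k, q, hq, N₀, hk⟩ := hv.exists_contraction
  obtain ⟨C, hC0, hC⟩ := exists_mul_sum_inv_le (fun n => v.pos (dyadicPt n)) hv.antitone_dyadic hq hk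
  rw [Metric.tendsto_nhds]
  intro ε hε
  -- This makes the sum contribute at most `ε / 2`. The bound `M` on the inner disc depends on this
  -- choice, so the threshold `K` for `v` is picked after it.
  have hε' : 0 < ε / (2 * D * C) := by positivity
  obtain ⟨r, hr, hr'⟩ := eventually_toBoundary.1 (hf.eventually (gt_mem_nhds hε'))
  obtain ⟨N, hN⟩ := (tendsto_norm_dyadicPt.eventually (lt_mem_nhds hr)).exists
  obtain ⟨M, hM0, hM⟩ := f.exists_norm_val_le (norm_dyadicPt_lt_one N)
  have hsmall : 0 < ε / (2 * D * M) := by positivity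
  obtain ⟨K, hK⟩ := eventually_atTop.1
    ((v.tendsto_zero.comp tendsto_dyadicPt).eventually (gt_mem_nhds hsmall))
  refine eventually_toBoundary.2 ⟨‖(dyadicPt (max K N) : ℂ)‖, norm_dyadicPt_lt_one _, fun z hz => ?_⟩
  rw [dist_zero_right, Real.norm_of_nonneg (mul_nonneg (v.pos z).le (norm_nonneg _))]
  obtain ⟨n, h1, h2⟩ := exists_dyadicPt_le_norm_lt z
  have hn := strictMono_norm_dyadicPt.lt_iff_lt.1 (hz.trans h2)
  have hKn : K ≤ n + 1 := (le_max_left K N).trans hn.le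
  have hNn : N ≤ n + 1 := (le_max_right K N).trans hn.le
  have h3 := hv.norm_val_le_sum hε' (fun w hw => (hr' w (hN.trans_le hw)).le) hM hNn z h2.le
  have h4 : v z ≤ D * v (dyadicPt (n + 1)) := (hv.antitone _ _ h1).trans (hD n)
  have h5 : v (dyadicPt (n + 1)) < ε / (2 * D * M) := hK _ hKn
  have h6 := hC (n + 1)
  set a := v (dyadicPt (n + 1))
  set s := ∑ j ∈ Finset.range (n + 1 + 1), (v (dyadicPt j))⁻¹
  calc v z * ‖f.val z‖ ≤ D * a * (M + ε / (2 * D * C) * s) :=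
        mul_le_mul h4 h3 (norm_nonneg _) (mul_nonneg hD0.le (v.pos _).le)
    _ = D * M * a + ε / (2 * D * C) * D * (a * s) := by ring
    _ < D * M * (ε / (2 * D * M)) + ε / (2 * D * C) * D * C :=
        add_lt_add_of_lt_of_le (mul_lt_mul_of_pos_left h5 (by positivity))
          (mul_le_mul_of_nonneg_left h6 (by positivity))
    _ = ε := by field_simp; norm_num

/-! ### Weighted spaces of normal weights as the range -/

section Growth

variable {X : Type*} [NormedAddCommGroup X] [NormedSpace ℂ X] {ι : X →ₗ[ℂ] HolD} {g : HolD}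
  {φ : SelfMap} {v : Weight}

/-- Condition (V), applied to the powers of the coordinate. -/
theorem CondV.exists_powMul (hV : CondV ι) (f : X) :
    ∃ (x : ℕ → X) (R : ℝ), (∀ n, ‖x n‖ ≤ R) ∧
      ∀ n z, (ι (x n)).val z = (z : ℂ) ^ n * (ι f).val z := by
  obtain ⟨c, hc, h⟩ := hV
  have hle : ∀ (n : ℕ) (z : Disc), ‖(z : ℂ) ^ n‖ ≤ 1 := fun n z => by
    rw [norm_pow]
    exact pow_le_one₀ (norm_nonneg _) (mem_ball_zero_iff.1 z.2).le
  choose m hm hmc using fun n : ℕ => h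
    (HolD.ofDifferentiableOn (fun z => z ^ n) (differentiable_pow n).differentiableOn)
    ⟨1, by rintro _ ⟨z, rfl⟩; exact hle n z⟩
  refine ⟨fun n => m n f, c * 1 * ‖f‖, fun n => ?_, fun n z => hm n f z⟩
  refine ((m n).le_opNorm f).trans (mul_le_mul_of_nonneg_right ((hmc n).trans ?_) (norm_nonneg f))
  have : Nonempty Disc := ⟨origin⟩
  exact mul_le_mul_of_nonneg_left (ciSup_le fun z => hle n z) hc.le

/-- Compactness upgrades the pointwise limit `φ^n (S f)' → 0` to a uniform weighted bound for a
suitable `n`. -/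
theorem exists_pow_mul_norm_der_le (hV : CondV ι) (hv : v.IsNormal) {S : X →ₗ[ℂ] HvInf v}
    (hS : ∀ f z, (HvInf.incl v (S f)).val z = volterra g φ (ι f) z) (hc : IsCompactOperator S)
    (f : X) {ε : ℝ} (hε : 0 < ε) :
    ∃ n : ℕ, ∀ z : Disc, ‖(φ.toFun z : ℂ)‖ ^ n *
      ((1 - ‖(z : ℂ)‖) * v z * ‖(HvInf.incl v (S f)).der z‖) ≤ ε := by
  obtain ⟨x, R, hxR, hx⟩ := hV.exists_powMul f
  obtain ⟨C, hC0, hC⟩ := hv.exists_mul_norm_der_le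
  obtain ⟨σ, hσ, h, hh⟩ := exists_subseq_tendsto_of_isCompactOperator hc hxR
  have hder : ∀ n z, (HvInf.incl v (S (x n))).der z =
      (φ.toFun z : ℂ) ^ n * (HvInf.incl v (S f)).der z := fun n z => by
    rw [der_of_val_eq_volterra (hS _), der_of_val_eq_volterra (hS _), hx, mul_assoc]
  -- The limit `h` is thus constant. It need not be shown to vanish, since the derivative estimate
  -- for `S (x (σ n)) - h` does not see it.
  have hzero : ∀ z, (HvInf.incl v h).der z = 0 := fun z => by
    refine tendsto_nhds_unique (HvInf.tendsto_der hv hh z) ?_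
    simp only [hder]
    simpa using ((tendsto_pow_atTop_nhds_zero_of_norm_lt_one (φ.norm_lt_one z)).comp
      hσ.tendsto_atTop).mul_const ((HvInf.incl v (S f)).der z)
  obtain ⟨n, hn⟩ := ((tendsto_iff_norm_sub_tendsto_zero.1 hh).eventually
    (gt_mem_nhds (div_pos hε hC0))).exists
  refine ⟨σ n, fun z => ?_⟩
  have h1 := hC (S (x (σ n)) - h) z
  rw [map_sub, HolD.der_sub, hzero, sub_zero, hder, norm_mul, norm_pow] at h1
  rw [lt_div_iff₀ hC0] at hn
  linarith

theorem exists_half_le_pow (n : ℕ) : ∃ ρ < (1 : ℝ), ∀ s > ρ, 1 / 2 ≤ s ^ n := by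
  have hlim : Tendsto (fun s : ℝ => s ^ n) (𝓝 1) (𝓝 1) := by
    simpa using (continuous_pow n).tendsto (1 : ℝ)
  obtain ⟨l, hl, h⟩ := mem_nhdsLE_iff_exists_Ioc_subset.1
    (mem_nhdsWithin_of_mem_nhds (hlim.eventually (lt_mem_nhds one_half_lt_one)))
  refine ⟨l, hl, fun s hs => ?_⟩
  rcases le_or_gt s 1 with h1 | h1
  · exact (h ⟨hs, h1⟩ : 1 / 2 < s ^ n).le
  · exact one_half_lt_one.le.trans (one_le_pow₀ h1.le)

theorem mem_Hv0_of_isCompactOperator (hV : CondV ι) (hv : v.IsNormal) {S : X →ₗ[ℂ] HvInf v}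
    (hS : ∀ f z, (HvInf.incl v (S f)).val z = volterra g φ (ι f) z) (hc : IsCompactOperator S)
    (f : X) : S f ∈ Hv0 v := by
  refine hv.tendsto_val_of_tendsto_der ?_
  rw [Metric.tendsto_nhds]
  intro ε hε
  -- Where `|φ|^n ≥ 1/2`, removing this factor turns `ε / 4` into `ε / 2 < ε`.
  obtain ⟨n, hn⟩ := exists_pow_mul_norm_der_le hV hv hS hc f (show 0 < ε / 4 by positivity)
  obtain ⟨ρ, hρ, hρn⟩ := exists_half_le_pow n
  obtain ⟨A, hA0, hA⟩ := (ι f).exists_norm_val_le hρ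
  obtain ⟨B, hB0, hB⟩ := g.exists_norm_der_le hρ
  filter_upwards [v.tendsto_zero.eventually
    (gt_mem_nhds (show 0 < ε / (2 * A * B) by positivity))] with z hz
  have hz1 : 0 < 1 - ‖(z : ℂ)‖ := sub_pos.2 (mem_ball_zero_iff.1 z.2)
  have hnonneg : 0 ≤ (1 - ‖(z : ℂ)‖) * v z * ‖(HvInf.incl v (S f)).der z‖ :=
    mul_nonneg (mul_nonneg hz1.le (v.pos z).le) (norm_nonneg _)
  rw [dist_zero_right, Real.norm_of_nonneg hnonneg]
  rcases lt_or_ge ρ ‖(φ.toFun z : ℂ)‖ with h | h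
  · have := mul_le_mul_of_nonneg_right (hρn _ h) hnonneg
    linarith [hn z]
  -- Here `φ z` stays in a compact disc, and `v → 0` alone gives the decay.
  · rw [lt_div_iff₀ (by positivity)] at hz
    refine lt_of_le_of_lt ?_ hz
    rw [der_of_val_eq_volterra (hS f), g.comp_der, norm_mul, norm_mul]
    calc (1 - ‖(z : ℂ)‖) * v z *
          (‖(ι f).val (φ.toFun z)‖ * (‖g.der (φ.toFun z)‖ * ‖φ.toHol.der z‖))
        = v z * (‖(ι f).val (φ.toFun z)‖ * ‖g.der (φ.toFun z)‖) *
          ((1 - ‖(z : ℂ)‖) * ‖φ.toHol.der z‖) := by ring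
      _ ≤ v z * (A * B) * 2 := by
          have hv0 := (v.pos z).le
          refine mul_le_mul ?_ (φ.norm_der_le z) (by positivity) (by positivity)
          gcongr
          · exact hA _ h
          · exact hB _ h
      _ = v z * (2 * A * B) := by ring

end Growth

end VolterraDisc

/-! ### The two equivalences -/

theorem theorem3p12 {X : Type*} [NormedAddCommGroup X] [NormedSpace ℂ X] [CompleteSpace X]
    (ι : X →ₗ[ℂ] HolD) (hι : Function.Injective ι) (hconst : ContainsConstants ι)
    (g : HolD) (φ : SelfMap) :
    (CondI ι → CondII ι → CondIII ι → CondIV ι → CondV ι →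
      ∀ v : Weight, v.IsNormal →
        (IsCompactBetween ι (HvInf.incl v) (volterra g φ) ↔
          IsCompactBetween ι (Hv0.incl v) (volterra g φ))) ∧
    (CondI ι → CondIV ι →
      ∀ v : Weight,
        (IsCompactBetween ι (Bv0.incl v) (volterra g φ) ↔
          IsCompactBetween ι (BvInf.incl v) (volterra g φ) ∧
            g.comp φ ∈ LinearMap.range (Bv0.incl v))) := by
  refine ⟨fun _ _ _ _ hV v hv => ⟨fun h => ?_, fun h => h.of_submodule⟩,
    fun _ hIV v => ⟨fun h => ⟨h.of_submodule, comp_mem_range_Bv0_incl hconst h⟩, fun h => ?_⟩⟩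
  · exact h.to_submodule (isClosed_Hv0 v) fun S hS hc =>
      mem_Hv0_of_isCompactOperator hV hv hS hc
  · exact h.1.to_submodule (isClosed_Bv0 v) fun S hS hc =>
      mem_Bv0_of_isCompactOperator hIV hS hc h.2
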